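/- Let $A$ be a complex $n\times n$ matrix that is stable (every eigenvalue $\lambda$ satisfies $|\lambda|<1$) and nonderogatory (every eigenvalue has exactly one Jordan block, i.e. geometric multiplicity one). Let $\lambda_1,\dots,\lambda_n$ be the eigenvalues of $A$, repeated according to algebraic multiplicity and listed in any order. Put $\rho_k=\sqrt{1-|\lambda_k|^2}$ for $1\le k\le n$, and $\mu_k=\rho_{k+1}/\rho_k$, $\gamma_k=\overline{\lambda_k}\,\mu_k$ for $1\le k\le n-1$. Let $M$ be the lower bidiagonal $n\times n$ matrix with diagonal entries $M_{k,k}=1$ and subdiagonal entries $M_{k+1,k}=\gamma_k$, and let $N$ be the lower bidiagonal $n\times n$ matrix with diagonal entries $N_{k,k}=\lambda_k$ and subdiagonal entries $N_{k+1,k}=\mu_k$ (all other entries of $M$ and $N$ are zero). Then $M$ is invertible, and there exists an invertible complex $n\times n$ matrix $T$ such that $TAT^{-1}=M^{-1}N$. -/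

import Mathlib

namespace BandFraction

/-- A square complex matrix is stable when all its eigenvalues lie in the open unit disc. -/
def IsStable {n : ℕ} (A : Matrix (Fin n) (Fin n) ℂ) : Prop :=
  ∀ z : ℂ, Module.End.HasEigenvalue (Matrix.toLin' A) z → ‖z‖ < 1

/-- A square complex matrix is nonderogatory when every eigenvalue has geometric multiplicity one.
The geometric multiplicity is the number of Jordan blocks belonging to the eigenvalue. -/
def IsNonderogatory {n : ℕ} (A : Matrix (Fin n) (Fin n) ℂ) : Prop :=
  ∀ z : ℂ, Module.End.HasEigenvalue (Matrix.toLin' A) z →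
    Module.finrank ℂ (Module.End.eigenspace (Matrix.toLin' A) z) = 1

/-- The family `l` lists the eigenvalues of `A`, each as often as its algebraic multiplicity,
in some order. -/
def ListsEigenvalues {n : ℕ} (A : Matrix (Fin n) (Fin n) ℂ) (l : Fin n → ℂ) : Prop :=
  Multiset.map l Finset.univ.val = A.charpoly.roots

/-- `ρ = √(1 - |z|²)`. -/
noncomputable def rho (z : ℂ) : ℝ := Real.sqrt (1 - ‖z‖ ^ 2)

/-- The lower bidiagonal matrix `M`: ones on the diagonal, and the entry in row `k + 1`, column `k`
is `γ_k = conj (l_k) * μ_k` with `μ_k = ρ_{k+1} / ρ_k`. -/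
noncomputable def bidiagM {n : ℕ} (l : Fin n → ℂ) : Matrix (Fin n) (Fin n) ℂ :=
  Matrix.of fun i j =>
    if i = j then 1
    else if (i : ℕ) = (j : ℕ) + 1 then
      (starRingEnd ℂ) (l j) * ((rho (l i) / rho (l j) : ℝ) : ℂ)
    else 0

/-- The lower bidiagonal matrix `N`: the `l_k` on the diagonal, and the entry in row `k + 1`,
column `k` is `μ_k = ρ_{k+1} / ρ_k`. -/
noncomputable def bidiagN {n : ℕ} (l : Fin n → ℂ) : Matrix (Fin n) (Fin n) ℂ :=
  Matrix.of fun i j =>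
    if i = j then l i
    else if (i : ℕ) = (j : ℕ) + 1 then ((rho (l i) / rho (l j) : ℝ) : ℂ)
    else 0

/-- `A` has the bidiagonal fraction representation with parameters `l`: all parameters are in the
open unit disc, `M` is invertible and `A = M⁻¹ N`. -/
def HasBidiagonalFraction {n : ℕ} (A : Matrix (Fin n) (Fin n) ℂ) (l : Fin n → ℂ) : Prop :=
  (∀ k, ‖l k‖ < 1) ∧ IsUnit (bidiagM l) ∧ A = (bidiagM l)⁻¹ * bidiagN l

end BandFraction

open Polynomial

namespace BandFraction

/-! Let `p_i = ∏_{j>i} (X - l_j) ∏_{j<i} (1 - conj l_j X)` and, for a functional `φ`, let `T x` have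
coordinates `ρ_i φ(p_i(A) x)`. The relation `p_{i+1} (X - l_{i+1}) = p_i (1 - conj l_i X)`, with
Cayley–Hamilton for the first row, says exactly that `M T A = N T`. Since `M` is unitriangular, `ker
T` is `A`-invariant, so if nonzero it contains an eigenvector `x`, say for `z`. But `(T x)_i = ρ_i
p_i(z) φ(x)`, and some `p_i(z)` is nonzero. As eigenspaces are lines, `φ` can be chosen nonzero on
every eigenvector; hence `T` is invertible. -/

/-- A linear functional that vanishes on no eigenvector exists when all eigenspaces are lines. -/
theorem exists_dual_apply_eigenvector_ne_zero {K V : Type*} [Field K] [AddCommGroup V] [Module K V]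
    (f : Module.End K V)
    (hf : ∀ z, f.HasEigenvalue z → Module.finrank K (f.eigenspace z) = 1) :
    ∃ φ : Module.Dual K V, ∀ z x, f.HasEigenvector z x → φ x ≠ 0 := by
  choose v hv using fun z : {z // f.HasEigenvalue z} => z.2.exists_hasEigenvector
  -- Eigenvectors for distinct eigenvalues are independent, so one functional can equal 1 on a
  -- chosen vector of each eigenline.
  obtain ⟨φ, hφ⟩ := Module.exists_dual_forall_apply_eq_one
    (linearIndepOn_univ_iff.2
      (f.eigenvectors_linearIndependent' Subtype.val Subtype.val_injective v hv))
  refine ⟨φ, fun z x hx => ?_⟩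
  have hz : f.HasEigenvalue z := Module.End.hasEigenvalue_of_hasEigenvector hx
  obtain ⟨c, hc⟩ := (finrank_eq_one_iff_of_nonzero' (⟨v ⟨z, hz⟩, (hv ⟨z, hz⟩).1⟩ : f.eigenspace z)
    (by simpa [Subtype.ext_iff] using (hv ⟨z, hz⟩).2)).1 (hf z hz) ⟨x, hx.1⟩
  have hc' : c • v ⟨z, hz⟩ = x := congrArg Subtype.val hc
  rw [← hc', map_smul, hφ _ (Set.mem_univ _), smul_eq_mul, mul_one]
  rintro rfl
  exact hx.2 (by simpa using hc'.symm)

/-- A linear map whose kernel is `f`-invariant and contains no eigenvector of `f` is injective. -/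
theorem ker_eq_bot_of_forall_eigenvector {K V W : Type*} [Field K] [IsAlgClosed K] [AddCommGroup V]
    [Module K V] [FiniteDimensional K V] [AddCommGroup W] [Module K W] (f : Module.End K V)
    (g : V →ₗ[K] W) (hinv : ∀ x, g x = 0 → g (f x) = 0)
    (hg : ∀ z x, f.HasEigenvector z x → g x ≠ 0) : LinearMap.ker g = ⊥ := by
  by_contra hne
  have : Nontrivial (LinearMap.ker g) := Submodule.nontrivial_iff_ne_bot.2 hne
  have hmaps : ∀ x ∈ LinearMap.ker g, f x ∈ LinearMap.ker g := fun x hx => hinv x hx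
  obtain ⟨z, hz⟩ := Module.End.exists_eigenvalue (f.restrict hmaps)
  obtain ⟨x, hx⟩ := hz.exists_hasEigenvector
  refine hg z x ⟨?_, fun h => hx.2 (Subtype.ext h)⟩ x.2
  exact Module.End.mem_eigenspace_iff.2 (congrArg Subtype.val hx.apply_eq_smul)

variable {n : ℕ}

/-- The numerator `∏_{j > i} (X - l_j) ∏_{j < i} (1 - conj l_j X)` of the `i`-th
Takenaka–Malmquist function of the listed points. -/
noncomputable def tmNumerator (l : Fin n → ℂ) (i : Fin n) : ℂ[X] :=
  (∏ j ∈ Finset.Ioi i, (X - C (l j))) * ∏ j ∈ Finset.Iio i, (1 - C ((starRingEnd ℂ) (l j)) * X)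

theorem tmNumerator_mul_of_val_eq_zero (l : Fin n → ℂ) {i : Fin n} (hi : (i : ℕ) = 0) :
    tmNumerator l i * (X - C (l i)) = ∏ j, (X - C (l j)) := by
  have hlow : Finset.Iio i = ∅ := by ext j; simp [Fin.lt_def, hi]
  have hup : Finset.univ = insert i (Finset.Ioi i) := by
    ext j
    simp only [Finset.mem_univ, Finset.mem_insert, Finset.mem_Ioi, Fin.lt_def, Fin.ext_iff,
      true_iff]
    omega
  rw [tmNumerator, hlow, hup, Finset.prod_insert (by simp), Finset.prod_empty, mul_one, mul_comm]

/-- Passing from `p` to its successor `i` trades the factor `X - l_i` for `1 - conj l_p X`. This is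
row `i` of the intertwining relation. -/
theorem tmNumerator_mul_of_val_eq_succ (l : Fin n → ℂ) {i p : Fin n} (hi : (i : ℕ) = p + 1) :
    tmNumerator l i * (X - C (l i)) =
      tmNumerator l p * (1 - C ((starRingEnd ℂ) (l p)) * X) := by
  have hlow : Finset.Iio i = insert p (Finset.Iio p) := by
    ext j
    simp only [Finset.mem_insert, Finset.mem_Iio, Fin.lt_def, Fin.ext_iff]
    omega
  have hup : Finset.Ioi p = insert i (Finset.Ioi i) := by
    ext j
    simp only [Finset.mem_insert, Finset.mem_Ioi, Fin.lt_def, Fin.ext_iff]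
    omega
  rw [tmNumerator, tmNumerator, hlow, hup, Finset.prod_insert (by simp),
    Finset.prod_insert (by simp)]
  ring

theorem one_sub_star_mul_ne_zero {a z : ℂ} (ha : ‖a‖ < 1) (hz : ‖z‖ < 1) :
    1 - (starRingEnd ℂ) a * z ≠ 0 := by
  intro h
  have h1 : ‖(starRingEnd ℂ) a * z‖ = 1 := by rw [← sub_eq_zero.1 h, norm_one]
  rw [norm_mul, RCLike.norm_conj] at h1
  nlinarith [norm_nonneg a, norm_nonneg z]

/-- At a listed point, the numerator belonging to its last occurrence does not vanish. -/
theorem exists_eval_tmNumerator_ne_zero (l : Fin n → ℂ) (hl : ∀ k, ‖l k‖ < 1) {z : ℂ}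
    (hz : ∃ k, l k = z) : ∃ k, (tmNumerator l k).eval z ≠ 0 := by
  classical
  obtain ⟨k₀, rfl⟩ := hz
  -- For the last index `k` with this value, no factor `X - l_j` with `j > k` vanishes there.
  obtain ⟨k, hk, hmax⟩ := (Finset.univ.filter fun j => l j = l k₀).exists_max_image id
    ⟨k₀, by simp⟩
  refine ⟨k, ?_⟩
  rw [tmNumerator, eval_mul, eval_prod, eval_prod]
  refine mul_ne_zero (Finset.prod_ne_zero_iff.2 fun j hj => ?_)
    (Finset.prod_ne_zero_iff.2 fun j _ => ?_)
  · rw [eval_sub, eval_X, eval_C]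
    intro h
    exact absurd (hmax j (by simp [sub_eq_zero.1 h])) (not_le.2 (Finset.mem_Ioi.1 hj))
  · simpa using one_sub_star_mul_ne_zero (hl j) (hl k₀)

theorem rho_pos {z : ℂ} (hz : ‖z‖ < 1) : 0 < rho z :=
  Real.sqrt_pos.2 (by nlinarith [norm_nonneg z])

theorem det_bidiagM (l : Fin n → ℂ) : (bidiagM l).det = 1 := by
  rw [Matrix.det_of_isLowerTriangular]
  · simp [bidiagM]
  · intro i j hij
    have hij' : i < j := hij
    have h1 : i ≠ j := hij'.ne
    have h2 : (i : ℕ) ≠ j + 1 := by have := Fin.lt_def.1 hij'; omega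
    simp [bidiagM, h1, h2]

theorem bidiagM_mulVec_of_val_eq_zero (l x : Fin n → ℂ) {i : Fin n} (hi : (i : ℕ) = 0) :
    (bidiagM l).mulVec x i = x i := by
  simp [Matrix.mulVec, dotProduct, bidiagM, hi]

theorem bidiagN_mulVec_of_val_eq_zero (l x : Fin n → ℂ) {i : Fin n} (hi : (i : ℕ) = 0) :
    (bidiagN l).mulVec x i = l i * x i := by
  simp [Matrix.mulVec, dotProduct, bidiagN, hi]

theorem bidiagM_mulVec_of_val_eq_succ (l x : Fin n → ℂ) {i p : Fin n} (hi : (i : ℕ) = p + 1) :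
    (bidiagM l).mulVec x i =
      x i + (starRingEnd ℂ) (l p) * ((rho (l i) / rho (l p) : ℝ) : ℂ) * x p := by
  have hip : i ≠ p := by simp [Fin.ext_iff, hi]
  rw [Matrix.mulVec, dotProduct, Finset.sum_eq_add i p hip]
  · simp [bidiagM, hip, hi]
  · intro c _ hc
    have h2 : (i : ℕ) ≠ c + 1 := fun h => hc.2 (Fin.ext (by omega))
    simp [bidiagM, hc.1.symm, h2]
  · simp
  · simp

theorem bidiagN_mulVec_of_val_eq_succ (l x : Fin n → ℂ) {i p : Fin n} (hi : (i : ℕ) = p + 1) :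
    (bidiagN l).mulVec x i = l i * x i + ((rho (l i) / rho (l p) : ℝ) : ℂ) * x p := by
  have hip : i ≠ p := by simp [Fin.ext_iff, hi]
  rw [Matrix.mulVec, dotProduct, Finset.sum_eq_add i p hip]
  · simp [bidiagN, hip, hi]
  · intro c _ hc
    have h2 : (i : ℕ) ≠ c + 1 := fun h => hc.2 (Fin.ext (by omega))
    simp [bidiagN, hc.1.symm, h2]
  · simp
  · simp

/-- The coordinates `ρ_i φ(p_i(f) x)`, where `p_i` is the `i`-th Takenaka–Malmquist numerator. -/
noncomputable def tmCoords {V : Type*} [AddCommGroup V] [Module ℂ V] (l : Fin n → ℂ)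
    (f : Module.End ℂ V) (φ : Module.Dual ℂ V) : V →ₗ[ℂ] (Fin n → ℂ) :=
  LinearMap.pi fun i => (rho (l i) : ℂ) • φ ∘ₗ aeval f (tmNumerator l i)

theorem tmCoords_apply {V : Type*} [AddCommGroup V] [Module ℂ V] (l : Fin n → ℂ)
    (f : Module.End ℂ V) (φ : Module.Dual ℂ V) (x : V) (i : Fin n) :
    tmCoords l f φ x i = rho (l i) * φ (aeval f (tmNumerator l i) x) := rfl

/-- The coordinates intertwine `f` with the pencil of the two bidiagonal matrices, provided
the listed points are the roots of a polynomial annihilating `f`. -/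
theorem bidiagM_mulVec_tmCoords {V : Type*} [AddCommGroup V] [Module ℂ V] (l : Fin n → ℂ)
    (hl : ∀ k, ‖l k‖ < 1) (f : Module.End ℂ V) (hf : aeval f (∏ j, (X - C (l j))) = 0)
    (φ : Module.Dual ℂ V) (x : V) :
    (bidiagM l).mulVec (tmCoords l f φ (f x)) = (bidiagN l).mulVec (tmCoords l f φ x) := by
  have hmul : ∀ (p : ℂ[X]) (a b : ℂ), aeval f (p * (C a + C b * X)) x
      = a • aeval f p x + b • aeval f p (f x) := by
    intro p a b
    simp [mul_add, Module.algebraMap_end_apply]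
  have hlin (i : Fin n) : aeval f (tmNumerator l i * (X - C (l i))) x
      = aeval f (tmNumerator l i) (f x) - l i • aeval f (tmNumerator l i) x := by
    have := hmul (tmNumerator l i) (-l i) 1
    rw [show (C (-l i) + C 1 * X : ℂ[X]) = X - C (l i) by simp; ring] at this
    rw [this, neg_smul, one_smul]; abel
  ext i
  by_cases hi : (i : ℕ) = 0
  · rw [bidiagM_mulVec_of_val_eq_zero _ _ hi, bidiagN_mulVec_of_val_eq_zero _ _ hi,
      tmCoords_apply, tmCoords_apply]
    have h := hlin i
    -- In the first row the product is the full annihilating polynomial.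
    rw [tmNumerator_mul_of_val_eq_zero l hi, hf, LinearMap.zero_apply, eq_comm, sub_eq_zero] at h
    rw [h, map_smul, smul_eq_mul]; ring
  · obtain ⟨p, hp⟩ : ∃ p : Fin n, (i : ℕ) = p + 1 :=
      ⟨⟨i - 1, by omega⟩, by simp only; omega⟩
    rw [bidiagM_mulVec_of_val_eq_succ _ _ hp, bidiagN_mulVec_of_val_eq_succ _ _ hp]
    simp only [tmCoords_apply]
    have h := hlin i
    have h' := hmul (tmNumerator l p) 1 (-(starRingEnd ℂ) (l p))
    rw [show (C 1 + C (-(starRingEnd ℂ) (l p)) * X : ℂ[X]) = 1 - C ((starRingEnd ℂ) (l p)) * X by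
      simp; ring, ← tmNumerator_mul_of_val_eq_succ l hp, h] at h'
    have h2 := congrArg φ h'
    simp only [map_sub, map_add, map_smul, smul_eq_mul] at h2
    have hρ : (rho (l p) : ℂ) ≠ 0 := by exact_mod_cast (rho_pos (hl p)).ne'
    -- The weight `ρ_p` of coordinate `p` cancels the denominator of `μ_p`, leaving `ρ_i` times the
    -- recursion.
    push_cast
    field_simp
    linear_combination (rho (l i) : ℂ) * h2

theorem tmCoords_eigenvector_ne_zero {V : Type*} [AddCommGroup V] [Module ℂ V] (l : Fin n → ℂ)
    (hl : ∀ k, ‖l k‖ < 1) (f : Module.End ℂ V) (φ : Module.Dual ℂ V) {z : ℂ} {x : V}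
    (hz : ∃ k, l k = z) (hx : f.HasEigenvector z x) (hφ : φ x ≠ 0) : tmCoords l f φ x ≠ 0 := by
  obtain ⟨k, hk⟩ := exists_eval_tmNumerator_ne_zero l hl hz
  intro h
  have hk0 := congrFun h k
  rw [tmCoords_apply, Module.End.aeval_apply_of_hasEigenvector hx, map_smul, smul_eq_mul] at hk0
  have hρ : (rho (l k) : ℂ) ≠ 0 := by exact_mod_cast (rho_pos (hl k)).ne'
  exact mul_ne_zero hρ (mul_ne_zero hk hφ) hk0

theorem hasEigenvalue_toLin'_iff_mem_roots (A : Matrix (Fin n) (Fin n) ℂ) (z : ℂ) :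
    Module.End.HasEigenvalue (Matrix.toLin' A) z ↔ z ∈ A.charpoly.roots := by
  rw [Module.End.hasEigenvalue_iff_isRoot_charpoly, Matrix.charpoly_toLin',
    mem_roots A.charpoly_monic.ne_zero]

theorem exists_listsEigenvalues (A : Matrix (Fin n) (Fin n) ℂ) :
    ∃ l : Fin n → ℂ, ListsEigenvalues A l := by
  have hcard : A.charpoly.roots.toList.length = n := by
    rw [Multiset.length_toList, splits_iff_card_roots.1 (IsAlgClosed.splits _),
      Matrix.charpoly_natDegree_eq_dim, Fintype.card_fin]
  refine ⟨fun i => A.charpoly.roots.toList.get (i.cast hcard.symm), ?_⟩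
  rw [ListsEigenvalues, Fin.univ_val_map]
  refine Eq.trans (congrArg _ ?_) (Multiset.coe_toList A.charpoly.roots)
  apply List.ext_get
  · simpa using hcard.symm
  · simp

theorem ListsEigenvalues.hasEigenvalue_iff {A : Matrix (Fin n) (Fin n) ℂ} {l : Fin n → ℂ}
    (h : ListsEigenvalues A l) (z : ℂ) :
    Module.End.HasEigenvalue (Matrix.toLin' A) z ↔ ∃ k, l k = z := by
  rw [hasEigenvalue_toLin'_iff_mem_roots, ← h]
  simp

theorem ListsEigenvalues.charpoly_eq {A : Matrix (Fin n) (Fin n) ℂ} {l : Fin n → ℂ}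
    (h : ListsEigenvalues A l) : A.charpoly = ∏ j, (X - C (l j)) := by
  rw [(IsAlgClosed.splits A.charpoly).eq_prod_roots_of_monic A.charpoly_monic, ← h,
    Multiset.map_map]
  rfl

theorem ListsEigenvalues.aeval_toLin'_prod {A : Matrix (Fin n) (Fin n) ℂ} {l : Fin n → ℂ}
    (h : ListsEigenvalues A l) : aeval (Matrix.toLin' A) (∏ j, (X - C (l j))) = 0 := by
  rw [← h.charpoly_eq, ← Matrix.charpoly_toLin', LinearMap.aeval_self_charpoly]

end BandFraction

theorem mainTheorem10 {n : ℕ} (A : Matrix (Fin n) (Fin n) ℂ)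
    (hstable : BandFraction.IsStable A) (hnd : BandFraction.IsNonderogatory A) :
    (∃ l : Fin n → ℂ, BandFraction.ListsEigenvalues A l) ∧
    ∀ l : Fin n → ℂ, BandFraction.ListsEigenvalues A l →
      ∃ T : Matrix (Fin n) (Fin n) ℂ, IsUnit T ∧
        BandFraction.HasBidiagonalFraction (T * A * T⁻¹) l := by
  refine ⟨BandFraction.exists_listsEigenvalues A, fun l hlist => ?_⟩
  have hl : ∀ k, ‖l k‖ < 1 := fun k => hstable _ ((hlist.hasEigenvalue_iff _).2 ⟨k, rfl⟩)
  obtain ⟨φ, hφ⟩ := BandFraction.exists_dual_apply_eigenvector_ne_zero _ hnd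
  have hMdet : IsUnit (BandFraction.bidiagM l).det := by
    rw [BandFraction.det_bidiagM]; exact isUnit_one
  have hM : IsUnit (BandFraction.bidiagM l) := (Matrix.isUnit_iff_isUnit_det _).2 hMdet
  have hint := BandFraction.bidiagM_mulVec_tmCoords l hl _ hlist.aeval_toLin'_prod φ
  have hker := BandFraction.ker_eq_bot_of_forall_eigenvector (Matrix.toLin' A)
    (BandFraction.tmCoords l (Matrix.toLin' A) φ)
    -- If `T x = 0` then `M (T (A x)) = N (T x) = 0`, and `M` is injective.
    (fun x hx => Matrix.mulVec_injective_of_isUnit hM (by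
      simp only [hint x, hx, Matrix.mulVec_zero]))
    (fun z x hx => BandFraction.tmCoords_eigenvector_ne_zero l hl _ φ
      ((hlist.hasEigenvalue_iff z).1 (Module.End.hasEigenvalue_of_hasEigenvector hx)) hx
      (hφ z x hx))
  set T : Matrix (Fin n) (Fin n) ℂ :=
    LinearMap.toMatrix' (BandFraction.tmCoords l (Matrix.toLin' A) φ) with hTdef
  have hTx (x : Fin n → ℂ) :
      T.mulVec x = BandFraction.tmCoords l (Matrix.toLin' A) φ x := by
    rw [hTdef, LinearMap.toMatrix'_mulVec]
  have hT : IsUnit T := by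
    rw [← Matrix.mulVec_injective_iff_isUnit]
    intro x y hxy
    simp only [hTx] at hxy
    exact LinearMap.ker_eq_bot.1 hker hxy
  have hTdet : IsUnit T.det := (Matrix.isUnit_iff_isUnit_det _).1 hT
  refine ⟨T, hT, hl, hM, ?_⟩
  have hMTA : BandFraction.bidiagM l * (T * A) = BandFraction.bidiagN l * T := by
    apply Matrix.ext_of_mulVec_single
    intro i
    simp only [← Matrix.mulVec_mulVec, hTx]
    simpa only [Matrix.toLin'_apply] using hint (Pi.single i 1)
  rw [← Matrix.nonsing_inv_mul_cancel_left _ (T * A) hMdet, hMTA, ← Matrix.mul_assoc,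
    Matrix.mul_nonsing_inv_cancel_right _ _ hTdet]
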